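/- Let $\mathcal{C}$ be an integral domain, $\mathcal{Q}\subset\mathcal{C}$ a prime ideal, $x=(x_1,\dots,x_n)$, and let $\prec$ be a local order, i.e. a total order on the monomials $x^\alpha$ ($\alpha\in\mathbb{N}^n$), compatible with products, with $x^\alpha\preceq 1$ for all $\alpha$. Assume that $\mathcal{C}/\mathcal{Q}$ is Noetherian, or that for every $\alpha$ only finitely many monomials $x^\beta$ satisfy $x^\beta\succ x^\alpha$. For a non-zero power series $f$ over a field, $\exp(f)$ is the largest exponent (for $\prec$) of a monomial occurring in $f$; for an ideal $I$ of power series over a field, $\mathrm{Exp}(I)=\{\exp(f): f\in I\smallsetminus\{0\}\}$, and a standard basis of $I$ is a finite set $G$ of non-zero elements of $I$ with $\mathrm{Exp}(I)=\bigcup_{g\in G}(\exp(g)+\mathbb{N}^n)$. For $h\in\mathcal{C}\smallsetminus\mathcal{Q}$ and $f$ in $\mathcal{C}[[x]]$ or $\mathcal{C}[h^{-1}][[x]]$, not all of whose coefficients lie in $\mathcal{Q}$ (resp. $\mathcal{Q}[h^{-1}]$), $\exp^{\mathrm{mod}\mathcal{Q}}(f)$ is the largest $\alpha$ such that the coefficient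 of $x^\alpha$ is not in $\mathcal{Q}$ (resp. $\mathcal{Q}[h^{-1}]$), and $\mathrm{lc}^{\mathrm{mod}\mathcal{Q}}(f)$ is that coefficient. For an ideal $J\subset\mathcal{C}[[x]]$, $\mathrm{Exp}^{\mathrm{mod}\mathcal{Q}}(J)=\{\exp^{\mathrm{mod}\mathcal{Q}}(f): f\in J\smallsetminus\mathcal{Q}[[x]]\}$. A generic standard basis of $J$ on $V(\mathcal{Q})$ is a pair $(\mathcal{G},h)$ where (a) $h\in\mathcal{C}\smallsetminus\mathcal{Q}$; (b) $\mathcal{G}$ is a finite subset of the ideal $\mathcal{C}[h^{-1}][[x]]\cdot J$, no element of $\mathcal{G}$ has all its coefficients in $\mathcal{Q}[h^{-1}]$, and for each $g\in\mathcal{G}$ one can write $\mathrm{lc}^{\mathrm{mod}\mathcal{Q}}(g)=c/c'$ with $c,c'\in\mathcal{C}$, $c'\notin\mathcal{Q}$ and $c$ dividing $h$; (c) $\mathrm{Exp}^{\mathrm{mod}\mathcal{Q}}(J)=\bigcup_{g\in\mathcal{G}}(\exp^{\mathrm{mod}\mathcal{Q}}(g)+\mathbb{N}^n)$. For a prime $\mathcal{P}$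 of $\mathcal{C}$ with $h\notin\mathcal{P}$, the specialization $(f)_\mathcal{P}$ of $f\in\mathcal{C}[h^{-1}][[x]]$ is its coefficientwise image over $\mathrm{Frac}(\mathcal{C}/\mathcal{P})$; $(\mathcal{G})_\mathcal{P}=\{(g)_\mathcal{P}:g\in\mathcal{G}\}$, and $(J)_\mathcal{P}$ is the ideal of $\mathrm{Frac}(\mathcal{C}/\mathcal{P})[[x]]$ generated by all $(f)_\mathcal{P}$, $f\in J$. Theorem. Let $(\mathcal{G},h)$ be a generic standard basis of an ideal $J\subset\mathcal{C}[[x]]$ on $V(\mathcal{Q})$. Then for every prime $\mathcal{P}\supset\mathcal{Q}$ with $h\notin\mathcal{P}$: (i) $(\mathcal{G})_\mathcal{P}\subset (J)_\mathcal{P}$; (ii) $\mathrm{Exp}((J)_\mathcal{P})=\bigcup_{g\in\mathcal{G}}(\exp((g)_\mathcal{P})+\mathbb{N}^n)=\mathrm{Exp}^{\mathrm{mod}\mathcal{Q}}(J)$; in particular the elements of $(\mathcal{G})_\mathcal{P}$ are non-zero and $(\mathcal{G})_\mathcal{P}$ is a standard basis of $(J)_\mathcal{P}$. -/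

import Mathlib

/-!
Standard bases of ideals of formal power series for local monomial orders, and their
generic (parametric) version over a domain of parameters.
Exponents are finitely supported functions `Fin n →₀ ℕ`, i.e. elements of `ℕⁿ`.
-/

noncomputable section

namespace GenericSB

/-- A local monomial order on the monomials in `x₁, …, xₙ` (written on exponents): a total order
compatible with products for which `x ^ α ≼ 1` for every `α`. -/
structure LocalOrder (n : ℕ) where
  /-- `le α β` means `x ^ α ≼ x ^ β`. -/
  le : (Fin n →₀ ℕ) → (Fin n →₀ ℕ) → Prop
  le_refl : ∀ α, le α α
  le_trans : ∀ α β γ, le α β → le β γ → le α γ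
  le_antisymm : ∀ α β, le α β → le β α → α = β
  le_total : ∀ α β, le α β ∨ le β α
  add_le_add : ∀ α β γ, le α β → le (α + γ) (β + γ)
  le_zero : ∀ α, le α 0

variable {n : ℕ}

/-- The strict order `x ^ α ≺ x ^ β`. -/
def LocalOrder.lt (ord : LocalOrder n) (α β : Fin n →₀ ℕ) : Prop := ord.le α β ∧ α ≠ β

/-- For a local order, every non-empty set of exponents has a maximum. -/
theorem LocalOrder.exists_max (ord : LocalOrder n) (S : Set (Fin n →₀ ℕ)) (hS : S.Nonempty) :
    ∃ α ∈ S, ∀ β ∈ S, ord.le β α := by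
  by_contra! hcon
  have step : ∀ a : S, ∃ b : S, ¬ ord.le b.1 a.1 := by
    rintro ⟨a, ha⟩
    obtain ⟨b, hb, hba⟩ := hcon a ha
    exact ⟨⟨b, hb⟩, hba⟩
  choose next hnext using step
  obtain ⟨s, hs⟩ := hS
  let u : ℕ → S := fun k => next^[k] ⟨s, hs⟩
  have hu : ∀ k, ¬ ord.le (u (k + 1)).1 (u k).1 := by
    intro k
    have : u (k + 1) = next (u k) := Function.iterate_succ_apply' next k _
    rw [this]
    exact hnext _
  have hu1 : ∀ k, ord.le (u k).1 (u (k + 1)).1 := fun k =>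
    (ord.le_total _ _).resolve_right (hu k)
  have hmono : ∀ j k, ord.le (u j).1 (u (j + k)).1 := by
    intro j k
    induction k with
    | zero => exact ord.le_refl _
    | succ k ih => exact ord.le_trans _ _ _ ih (hu1 (j + k))
  obtain ⟨i, j, hij, hle⟩ := wellQuasiOrdered_le (fun k => (u k).1)
  obtain ⟨γ, hγ⟩ := exists_add_of_le hle
  have h1 : ord.le (u j).1 (u i).1 := by
    have := ord.add_le_add γ 0 (u i).1 (ord.le_zero γ)
    rw [zero_add, add_comm] at this
    rw [hγ]
    exact this
  obtain ⟨k, rfl⟩ := Nat.exists_eq_add_of_lt hij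
  apply hu i
  refine ord.le_trans _ _ _ ?_ h1
  have := hmono (i + 1) k
  rwa [show i + 1 + k = i + k + 1 by omega] at this

open Classical in
/-- The maximum of a set of exponents (`0` for the empty set, which is never used). -/
def LocalOrder.max (ord : LocalOrder n) (S : Set (Fin n →₀ ℕ)) : Fin n →₀ ℕ :=
  if hS : S.Nonempty then (ord.exists_max S hS).choose else 0

theorem LocalOrder.max_spec (ord : LocalOrder n) (S : Set (Fin n →₀ ℕ)) (hS : S.Nonempty) :
    ord.max S ∈ S ∧ ∀ β ∈ S, ord.le β (ord.max S) := by
  rw [LocalOrder.max, dif_pos hS]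
  exact (ord.exists_max S hS).choose_spec

/-- The translate `α + ℕⁿ`. -/
def translate (α : Fin n →₀ ℕ) : Set (Fin n →₀ ℕ) := Set.range fun γ => α + γ

section Field

variable {K : Type*} [Field K]

/-- The Newton diagram of a power series. -/
def newtonDiagram (f : MvPowerSeries (Fin n) K) : Set (Fin n →₀ ℕ) :=
  {α | MvPowerSeries.coeff α f ≠ 0}

/-- The leading exponent of a (non-zero) power series. -/
def leadExp (ord : LocalOrder n) (f : MvPowerSeries (Fin n) K) : Fin n →₀ ℕ :=
  ord.max (newtonDiagram f)

/-- `Exp(I)`, the set of leading exponents of the non-zero elements of an ideal. -/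
def expSet (ord : LocalOrder n) (I : Ideal (MvPowerSeries (Fin n) K)) : Set (Fin n →₀ ℕ) :=
  {α | ∃ f ∈ I, f ≠ 0 ∧ leadExp ord f = α}

/-- `G` is a standard basis of the ideal `I` with respect to the local order. -/
structure IsStandardBasis (ord : LocalOrder n) (I : Ideal (MvPowerSeries (Fin n) K))
    (G : Set (MvPowerSeries (Fin n) K)) : Prop where
  finite : G.Finite
  mem : ∀ g ∈ G, g ∈ I
  ne_zero : ∀ g ∈ G, g ≠ 0
  exp_eq : expSet ord I = ⋃ g ∈ G, translate (leadExp ord g)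

end Field

section Mod

variable {R : Type*} [CommRing R]

/-- The exponents of the coefficients of `f` that do not lie in the ideal `q`. -/
def newtonDiagramMod (q : Ideal R) (f : MvPowerSeries (Fin n) R) : Set (Fin n →₀ ℕ) :=
  {α | MvPowerSeries.coeff α f ∉ q}

/-- The leading exponent of `f` modulo `q` (for `f` not in `q[[x]]`). -/
def leadExpMod (ord : LocalOrder n) (q : Ideal R) (f : MvPowerSeries (Fin n) R) : Fin n →₀ ℕ :=
  ord.max (newtonDiagramMod q f)

/-- The leading coefficient of `f` modulo `q` (for `f` not in `q[[x]]`). -/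
def leadCoeffMod (ord : LocalOrder n) (q : Ideal R) (f : MvPowerSeries (Fin n) R) : R :=
  MvPowerSeries.coeff (leadExpMod ord q f) f

/-- The set of the leading exponents modulo `q` of the elements of `J` that are not in `q[[x]]`. -/
def expSetMod (ord : LocalOrder n) (q : Ideal R) (J : Ideal (MvPowerSeries (Fin n) R)) :
    Set (Fin n →₀ ℕ) :=
  {α | ∃ f ∈ J, (newtonDiagramMod q f).Nonempty ∧ leadExpMod ord q f = α}

end Mod

section Generic

variable {C : Type*} [CommRing C]

/-- The ideal of `C[h⁻¹]` generated by `Q`; for `Q` prime and `h ∉ Q` it is the set of the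
fractions `c / h ^ k` with `c ∈ Q`. -/
def extendAway (Q : Ideal C) (h : C) : Ideal (Localization.Away h) :=
  Q.map (algebraMap C (Localization.Away h))

/-- `(G, h)` is a generic standard basis of `J` on `V(Q)`: `h ∉ Q`; `G` is a finite subset of the
ideal generated by `J` in `C[h⁻¹][[x]]`; each `g ∈ G` has a leading exponent modulo `Q`, and its
leading coefficient modulo `Q` can be written `c / c'` with `c' ∉ Q` and a numerator `c` that
divides `h`; the leading exponents modulo `Q` of the elements of `G` generate those of `J`. -/
structure IsGenericStandardBasis (ord : LocalOrder n) (Q : Ideal C)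
    (J : Ideal (MvPowerSeries (Fin n) C)) (h : C)
    (G : Set (MvPowerSeries (Fin n) (Localization.Away h))) : Prop where
  notMem : h ∉ Q
  finite : G.Finite
  mem : ∀ g ∈ G, g ∈ J.map (MvPowerSeries.map (algebraMap C (Localization.Away h)))
  nonempty : ∀ g ∈ G, (newtonDiagramMod (extendAway Q h) g).Nonempty
  numerator_dvd : ∀ g ∈ G, ∃ c c' : C, c' ∉ Q ∧
    leadCoeffMod ord (extendAway Q h) g * algebraMap C (Localization.Away h) c' =
      algebraMap C (Localization.Away h) c ∧ c ∣ h
  exp_eq : expSetMod ord Q J = ⋃ g ∈ G, translate (leadExpMod ord (extendAway Q h) g)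

variable (P : Ideal C) [P.IsPrime]

/-- The specialization `c ↦ (c)_P`, from `C` to the fraction field of `C / P`. -/
def specialize : C →+* FractionRing (C ⧸ P) :=
  (algebraMap (C ⧸ P) (FractionRing (C ⧸ P))).comp (Ideal.Quotient.mk P)

theorem isUnit_specialize {h : C} (hP : h ∉ P) : IsUnit (specialize P h) := by
  rw [isUnit_iff_ne_zero]
  intro h0
  apply hP
  rw [specialize, RingHom.comp_apply,
    FaithfulSMul.algebraMap_eq_zero_iff (C ⧸ P) (FractionRing (C ⧸ P))] at h0
  exact Ideal.Quotient.eq_zero_iff_mem.mp h0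

/-- The specialization at `P` of elements of `C[h⁻¹]`, for `h ∉ P`. -/
def specializeAway {h : C} (hP : h ∉ P) : Localization.Away h →+* FractionRing (C ⧸ P) :=
  IsLocalization.Away.lift h (isUnit_specialize P hP)

/-- The specialization `(g)_P` of a power series with coefficients in `C[h⁻¹]`, for `h ∉ P`. -/
def specializeSeries {h : C} (hP : h ∉ P) (g : MvPowerSeries (Fin n) (Localization.Away h)) :
    MvPowerSeries (Fin n) (FractionRing (C ⧸ P)) :=
  MvPowerSeries.map (specializeAway P hP) g

/-- The specialization `(J)_P`: the ideal generated by the `(f)_P` with `f ∈ J`. -/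
def specializeIdeal (J : Ideal (MvPowerSeries (Fin n) C)) :
    Ideal (MvPowerSeries (Fin n) (FractionRing (C ⧸ P))) :=
  Ideal.span ((fun f => MvPowerSeries.map (specialize P) f) '' (J : Set (MvPowerSeries (Fin n) C)))

end Generic

end GenericSB

end

noncomputable section

namespace GenericSB

variable {n : ℕ}

open MvPowerSeries

/-! ### Order-theoretic preliminaries -/

section Order

/-! Put A = C[h⁻¹]/Q[h⁻¹]. A numerator dividing h is a unit of C[h⁻¹], so over A the elements of G
can be normalized to leading coefficient 1 with nothing above it. Division by such series works over
any ring: sending s = ∑ x ^ eⱼ qⱼ + r to ∑ qⱼ gⱼ + r is linear (`recombine`), unitriangular for the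
order, hence surjective, and compatible with ring homomorphisms.

Over A, elements of J leave no remainder: a non-zero remainder would lie in the extension of J, with
leading exponent outside Exp^{mod Q}(J), contradicting `mem_expSetMod_of_mem_map`. Zero remainder
passes to Frac(C/P), so each F in (J)_P comes from some s with r = 0. By unitriangularity F and s
have the same leading exponent, which therefore lies in the diagram. The other inclusion holds
because the leading terms of G survive specialization.

Two finiteness problems remain. An element of an ideal generated by J in a larger power series ring
agrees with a linear combination of elements of J, with constant coefficients, only at finitely many
exponents (`exists_mem_span_coeff_eq`). This suffices for remainders, since each coefficient of s
depends on finitely many coefficients of its image (`exists_finset_coeff_eq_zero`). For leading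
exponents, infinitely many coefficients above α may have to vanish: either the order excludes this,
or Artin–Rees over the Noetherian ring C/Q corrects the approximation
(`exists_forall_mem_lowerIdeal`). -/

theorem LocalOrder.lt_irrefl (ord : LocalOrder n) (α : Fin n →₀ ℕ) : ¬ ord.lt α α :=
  fun h => h.2 rfl

theorem LocalOrder.lt_of_lt_of_le (ord : LocalOrder n) {α β γ : Fin n →₀ ℕ}
    (h : ord.lt α β) (h' : ord.le β γ) : ord.lt α γ :=
  ⟨ord.le_trans _ _ _ h.1 h', fun e => h.2 (ord.le_antisymm _ _ h.1 (e ▸ h'))⟩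

theorem LocalOrder.not_lt (ord : LocalOrder n) {α β : Fin n →₀ ℕ} :
    ¬ ord.lt α β ↔ ord.le β α := by
  refine ⟨fun h => ?_, fun h h' => h'.2 (ord.le_antisymm _ _ h'.1 h)⟩
  rcases ord.le_total α β with h1 | h1
  · by_cases e : α = β
    · exact e ▸ ord.le_refl α
    · exact absurd ⟨h1, e⟩ h
  · exact h1

theorem LocalOrder.le_of_add (ord : LocalOrder n) (α γ : Fin n →₀ ℕ) :
    ord.le (α + γ) α := by
  have := ord.add_le_add γ 0 α (ord.le_zero γ)
  rwa [zero_add, add_comm] at this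

theorem LocalOrder.add_lt_add (ord : LocalOrder n) {α β : Fin n →₀ ℕ} (γ : Fin n →₀ ℕ)
    (h : ord.lt α β) : ord.lt (α + γ) (β + γ) :=
  ⟨ord.add_le_add _ _ _ h.1, fun e => h.2 (add_right_cancel e)⟩

/-- The reverse of a local order is well-founded. -/
theorem LocalOrder.wellFounded_gt (ord : LocalOrder n) :
    WellFounded fun α β : Fin n →₀ ℕ => ord.lt β α := by
  rw [WellFounded.wellFounded_iff_has_min]
  intro S hS
  obtain ⟨α, hα, hmax⟩ := ord.exists_max S hS
  exact ⟨α, hα, fun β hβ h => ord.not_lt.2 (hmax β hβ) h⟩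

theorem LocalOrder.max_eq (ord : LocalOrder n) {S : Set (Fin n →₀ ℕ)} {α : Fin n →₀ ℕ}
    (hα : α ∈ S) (h : ∀ β ∈ S, ord.le β α) : ord.max S = α :=
  ord.le_antisymm _ _ (h _ (ord.max_spec S ⟨α, hα⟩).1) ((ord.max_spec S ⟨α, hα⟩).2 α hα)

theorem mem_translate {α β : Fin n →₀ ℕ} : β ∈ translate α ↔ α ≤ β := by
  constructor
  · rintro ⟨γ, rfl⟩
    exact le_self_add
  · intro h
    obtain ⟨γ, rfl⟩ := exists_add_of_le h
    exact ⟨γ, rfl⟩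

end Order

/-! ### Division of power series over an arbitrary ring -/

section Division

variable {R : Type*} [CommRing R] {ι : Type*}

open Classical in
/-- The part of a series made of the monomials to which `σ` assigns `j`, divided by `x ^ e j`. -/
def quotientPart (σ : (Fin n →₀ ℕ) → Option ι) (e : ι → (Fin n →₀ ℕ)) (j : ι) :
    MvPowerSeries (Fin n) R →ₗ[R] MvPowerSeries (Fin n) R where
  toFun s := fun δ => if σ (δ + e j) = some j then coeff (δ + e j) s else 0
  map_add' s t := by
    funext δ
    change ite (σ (δ + e j) = some j) (coeff (δ + e j) (s + t)) 0 =
      ite (σ (δ + e j) = some j) (coeff (δ + e j) s) 0 + ite (σ (δ + e j) = some j) (coeff (δ + e j) t) 0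
    split_ifs <;> simp
  map_smul' a s := by
    funext δ
    change ite (σ (δ + e j) = some j) (coeff (δ + e j) (a • s)) 0 = a * ite (σ (δ + e j) = some j) (coeff (δ + e j) s) 0
    split_ifs <;> simp

open Classical in
/-- The part of a series made of the monomials to which `σ` assigns nothing. -/
def remainderPart (σ : (Fin n →₀ ℕ) → Option ι) :
    MvPowerSeries (Fin n) R →ₗ[R] MvPowerSeries (Fin n) R where
  toFun s := fun δ => if σ δ = none then coeff δ s else 0
  map_add' s t := by
    funext δ
    change ite (σ δ = none) (coeff (δ) (s + t)) 0 =
      ite (σ δ = none) (coeff (δ) s) 0 + ite (σ δ = none) (coeff (δ) t) 0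
    split_ifs <;> simp
  map_smul' a s := by
    funext δ
    change ite (σ δ = none) (coeff (δ) (a • s)) 0 = a * ite (σ δ = none) (coeff (δ) s) 0
    split_ifs <;> simp

open Classical in
theorem coeff_quotientPart (σ : (Fin n →₀ ℕ) → Option ι) (e : ι → (Fin n →₀ ℕ)) (j : ι)
    (s : MvPowerSeries (Fin n) R) (δ : Fin n →₀ ℕ) :
    coeff δ (quotientPart σ e j s) = if σ (δ + e j) = some j then coeff (δ + e j) s else 0 :=
  rfl

open Classical in
theorem coeff_remainderPart (σ : (Fin n →₀ ℕ) → Option ι)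
    (s : MvPowerSeries (Fin n) R) (δ : Fin n →₀ ℕ) :
    coeff δ (remainderPart σ s) = if σ δ = none then coeff δ s else 0 :=
  rfl

theorem sum_monomial_mul_quotientPart_add_remainderPart [Fintype ι]
    {σ : (Fin n →₀ ℕ) → Option ι} {e : ι → (Fin n →₀ ℕ)}
    (hσ : ∀ γ j, σ γ = some j → e j ≤ γ) (s : MvPowerSeries (Fin n) R) :
    ∑ j, monomial (e j) (1 : R) * quotientPart σ e j s + remainderPart σ s = s := by
  classical
  ext γ
  have key : ∀ j, coeff γ (monomial (e j) (1 : R) * quotientPart σ e j s) =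
      if σ γ = some j then coeff γ s else 0 := by
    intro j
    rw [coeff_monomial_mul, coeff_quotientPart]
    by_cases h : e j ≤ γ
    · rw [if_pos h, tsub_add_cancel_of_le h, one_mul]
    · rw [if_neg h, if_neg fun h' => h (hσ γ j h')]
  rw [map_add, map_sum, coeff_remainderPart, Finset.sum_congr rfl fun j _ => key j]
  cases h : σ γ with
  | none => simp
  | some i => simp

/-- The map `s ↦ ∑ qⱼ gⱼ + r`, where `s = ∑ x ^ eⱼ qⱼ + r` is the decomposition given by `σ`. -/
def recombine [Fintype ι] (σ : (Fin n →₀ ℕ) → Option ι) (e : ι → (Fin n →₀ ℕ))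
    (g : ι → MvPowerSeries (Fin n) R) : MvPowerSeries (Fin n) R →ₗ[R] MvPowerSeries (Fin n) R :=
  ∑ j, (LinearMap.mulRight R (g j)).comp (quotientPart σ e j) + remainderPart σ

theorem recombine_apply [Fintype ι] (σ : (Fin n →₀ ℕ) → Option ι) (e : ι → (Fin n →₀ ℕ))
    (g : ι → MvPowerSeries (Fin n) R) (s : MvPowerSeries (Fin n) R) :
    recombine σ e g s = ∑ j, quotientPart σ e j s * g j + remainderPart σ s := by
  simp [recombine]

/-- The splitting depends only on exponents, through `σ` and `e`, so it commutes with base change.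
This is what carries division over A to the residue fields. -/
theorem map_recombine [Fintype ι] {S : Type*} [CommRing S] (φ : R →+* S)
    (σ : (Fin n →₀ ℕ) → Option ι) (e : ι → (Fin n →₀ ℕ))
    (g : ι → MvPowerSeries (Fin n) R) (s : MvPowerSeries (Fin n) R) :
    map φ (recombine σ e g s) = recombine σ e (fun j => map φ (g j)) (map φ s) := by
  classical
  have h1 : ∀ j, map φ (quotientPart σ e j s) = quotientPart σ e j (map φ s) := by
    intro j
    ext δ
    simp only [coeff_map, coeff_quotientPart]
    split_ifs <;> simp
  have h2 : map φ (remainderPart σ s) = remainderPart σ (map φ s) := by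
    ext δ
    simp only [coeff_map, coeff_remainderPart]
    split_ifs <;> simp
  simp only [recombine_apply, map_add, map_sum, map_mul, h1, h2]

/-- `recombine` is unitriangular with respect to the order, with finite dependencies. -/
theorem exists_finset_coeff_recombine [Fintype ι] (ord : LocalOrder n)
    {σ : (Fin n →₀ ℕ) → Option ι} {e : ι → (Fin n →₀ ℕ)} {g : ι → MvPowerSeries (Fin n) R}
    (hσ : ∀ γ j, σ γ = some j → e j ≤ γ) (hg : ∀ j, coeff (e j) (g j) = 1)
    (hlt : ∀ j γ, ord.lt (e j) γ → coeff γ (g j) = 0) (β : Fin n →₀ ℕ) :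
    ∃ N : Finset (Fin n →₀ ℕ), ∀ s : MvPowerSeries (Fin n) R,
      (∀ γ ∈ N, ord.lt β γ → coeff γ s = 0) → coeff β (recombine σ e g s) = coeff β s := by
  classical
  -- The coefficient at β of a product involves the j-th quotient only at δ ≤ β, and there it is a
  -- coefficient of s at δ + eⱼ.
  refine ⟨(Finset.univ ×ˢ Finset.Iic β).image fun p : ι × (Fin n →₀ ℕ) => p.2 + e p.1,
    fun s hs => ?_⟩
  conv_rhs => rw [← sum_monomial_mul_quotientPart_add_remainderPart hσ s]
  rw [recombine_apply, map_add, map_add, map_sum, map_sum]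
  congr 1
  refine Finset.sum_congr rfl fun j _ => ?_
  -- The difference is qⱼ (gⱼ - x ^ eⱼ), whose second factor lives strictly below eⱼ; so p.1 + p.2 =
  -- β contributes only if p.1 + eⱼ ≻ β.
  rw [mul_comm (monomial (e j) (1 : R)), ← sub_eq_zero, ← map_sub, ← mul_sub, coeff_mul]
  refine Finset.sum_eq_zero fun p hp => ?_
  rw [Finset.HasAntidiagonal.mem_antidiagonal] at hp
  rw [coeff_quotientPart, map_sub]
  split_ifs with hj
  · by_cases hb : ord.lt p.2 (e j)
    · rw [hs, zero_mul]
      · refine Finset.mem_image.2 ⟨(j, p.1), ?_, rfl⟩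
        simp only [Finset.mem_product, Finset.mem_univ, Finset.mem_Iic, true_and]
        exact hp ▸ le_self_add
      · rw [← hp, add_comm p.1, add_comm p.1]
        exact ord.add_lt_add _ hb
    · rw [ord.not_lt] at hb
      have : coeff p.2 (g j) - coeff p.2 (monomial (e j) (1 : R)) = 0 := by
        by_cases he : p.2 = e j
        · rw [he, hg, coeff_monomial_same, sub_self]
        · rw [coeff_monomial_ne he, sub_zero]
          exact hlt j _ ⟨hb, Ne.symm he⟩
      rw [this, mul_zero]
  · rw [zero_mul]

variable [Fintype ι] (ord : LocalOrder n)
  {σ : (Fin n →₀ ℕ) → Option ι} {e : ι → (Fin n →₀ ℕ)} {g : ι → MvPowerSeries (Fin n) R}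

/-- Each coefficient of `s` is determined by finitely many coefficients of `recombine s`. -/
theorem exists_finset_coeff_eq_zero
    (hσ : ∀ γ j, σ γ = some j → e j ≤ γ) (hg : ∀ j, coeff (e j) (g j) = 1)
    (hlt : ∀ j γ, ord.lt (e j) γ → coeff γ (g j) = 0) (α : Fin n →₀ ℕ) :
    ∃ U : Finset (Fin n →₀ ℕ), ∀ s : MvPowerSeries (Fin n) R,
      (∀ γ ∈ U, coeff γ (recombine σ e g s) = 0) → coeff α s = 0 := by
  classical
  induction α using ord.wellFounded_gt.induction with
  | _ α ih =>
    obtain ⟨N, hN⟩ := exists_finset_coeff_recombine ord hσ hg hlt α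
    choose! U hU using ih
    -- Infinitely many exponents may lie above α, but only the finitely many in `N` are consulted.
    refine ⟨insert α ((N.filter (ord.lt α)).biUnion U), fun s hs => ?_⟩
    rw [← hN s]
    · exact hs α (Finset.mem_insert_self _ _)
    · intro γ hγ hαγ
      refine hU γ hαγ s fun δ hδ => hs δ (Finset.mem_insert_of_mem ?_)
      exact Finset.mem_biUnion.2 ⟨γ, Finset.mem_filter.2 ⟨hγ, hαγ⟩, hδ⟩

/-- Division of power series, for any local order. -/
theorem recombine_surjective
    (hσ : ∀ γ j, σ γ = some j → e j ≤ γ) (hg : ∀ j, coeff (e j) (g j) = 1)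
    (hlt : ∀ j γ, ord.lt (e j) γ → coeff γ (g j) = 0) :
    Function.Surjective (recombine σ e g) := by
  classical
  intro f
  -- Solve for s from the largest exponent down: the coefficient at β is fixed by the part of s
  -- strictly above β.
  let above (β : Fin n →₀ ℕ) (r : ∀ γ, ord.lt β γ → R) : MvPowerSeries (Fin n) R :=
    fun γ => if h : ord.lt β γ then r γ h else 0
  let s : MvPowerSeries (Fin n) R := ord.wellFounded_gt.fix fun β r =>
    coeff β f - coeff β (recombine σ e g (above β r))
  have hs : ∀ β, coeff β s =
      coeff β f - coeff β (recombine σ e g (above β fun γ _ => coeff γ s)) := fun β =>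
    ord.wellFounded_gt.fix_eq _ β
  refine ⟨s, ?_⟩
  ext β
  obtain ⟨N, hN⟩ := exists_finset_coeff_recombine ord hσ hg hlt β
  have hc : ∀ γ, coeff γ (above β fun γ _ => coeff γ s) = if ord.lt β γ then coeff γ s else 0 :=
    fun γ => rfl
  have h1 := hN (s - above β fun γ _ => coeff γ s) fun γ _ h => by
    rw [map_sub, hc, if_pos h, sub_self]
  rw [map_sub, map_sub, map_sub, hc, if_neg (ord.lt_irrefl β), sub_zero,
    sub_eq_iff_eq_add] at h1
  rw [h1, hs β, sub_add_cancel]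

/-- The leading exponent is preserved by `recombine`. -/
theorem coeff_recombine_of_forall_lt
    (hσ : ∀ γ j, σ γ = some j → e j ≤ γ) (hg : ∀ j, coeff (e j) (g j) = 1)
    (hlt : ∀ j γ, ord.lt (e j) γ → coeff γ (g j) = 0) {s : MvPowerSeries (Fin n) R}
    {β : Fin n →₀ ℕ} (h : ∀ γ, ord.lt β γ → coeff γ s = 0) :
    coeff β (recombine σ e g s) = coeff β s := by
  obtain ⟨N, hN⟩ := exists_finset_coeff_recombine ord hσ hg hlt β
  exact hN s fun γ _ => h γ

end Division

/-! ### Finite approximation in extended ideals -/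

section Truncation

variable {C R : Type*} [CommRing C] [CommRing R]

/-- The monomial is absorbed by J and its coefficient becomes a scalar. -/
theorem monomial_mul_mem_span (φ : C →+* R) (J : Ideal (MvPowerSeries (Fin n) C))
    (β : Fin n →₀ ℕ) (a : R) {x : MvPowerSeries (Fin n) R}
    (hx : x ∈ Submodule.span R (map φ '' (J : Set (MvPowerSeries (Fin n) C)))) :
    monomial β a * x ∈ Submodule.span R (map φ '' (J : Set (MvPowerSeries (Fin n) C))) := by
  induction hx using Submodule.span_induction with
  | mem y hy =>
    obtain ⟨z, hz, rfl⟩ := hy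
    have : monomial β a * map φ z = a • map φ (monomial β (1 : C) * z) := by
      rw [map_mul, map_monomial, map_one, ← smul_mul_assoc, ← map_smul, smul_eq_mul, mul_one]
    rw [this]
    exact Submodule.smul_mem _ _ (Submodule.subset_span ⟨_, J.mul_mem_left _ hz, rfl⟩)
  | zero => rw [mul_zero]; exact zero_mem _
  | add y z _ _ hy hz => rw [mul_add]; exact add_mem hy hz
  | smul b y _ hy => rw [mul_smul_comm]; exact Submodule.smul_mem _ _ hy

/-- An element of the extension of an ideal of power series agrees, at finitely many given
exponents, with a linear combination of elements of the original ideal. -/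
theorem exists_mem_span_coeff_eq (φ : C →+* R) (J : Ideal (MvPowerSeries (Fin n) C))
    {F : MvPowerSeries (Fin n) R} (hF : F ∈ J.map (map φ)) (U : Finset (Fin n →₀ ℕ)) :
    ∃ F' ∈ Submodule.span R (map φ '' (J : Set (MvPowerSeries (Fin n) C))),
      ∀ γ ∈ U, coeff γ F' = coeff γ F := by
  classical
  induction hF using Submodule.span_induction generalizing U with
  | mem x hx => exact ⟨x, Submodule.subset_span hx, fun _ _ => rfl⟩
  | zero => exact ⟨0, zero_mem _, fun _ _ => rfl⟩
  | add x y _ _ hx hy =>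
    obtain ⟨x', hx', hxe⟩ := hx U
    obtain ⟨y', hy', hye⟩ := hy U
    exact ⟨x' + y', add_mem hx' hy', fun γ hγ => by rw [map_add, map_add, hxe γ hγ, hye γ hγ]⟩
  | smul a x _ hx =>
    -- Coefficients of a product on `U` see both factors only on the downward closure of `U`, so `a`
    -- may be truncated to a polynomial.
    set V := U.biUnion fun u => Finset.Iic u with hV
    have hmem : ∀ {β γ}, γ ∈ U → β ≤ γ → β ∈ V := fun hγ hβ =>
      Finset.mem_biUnion.2 ⟨_, hγ, Finset.mem_Iic.2 hβ⟩
    obtain ⟨x', hx', hxe⟩ := hx V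
    refine ⟨(∑ β ∈ V, monomial β (coeff β a)) * x', ?_, fun γ hγ => ?_⟩
    · rw [Finset.sum_mul]
      refine sum_mem fun β _ => ?_
      exact monomial_mul_mem_span φ J β _ hx'
    · rw [smul_eq_mul, coeff_mul, coeff_mul]
      refine Finset.sum_congr rfl fun p hp => ?_
      rw [Finset.HasAntidiagonal.mem_antidiagonal] at hp
      have h1 : p.1 ∈ V := hmem hγ (hp ▸ le_self_add)
      have h2 : p.2 ∈ V := hmem hγ (hp ▸ le_add_self)
      rw [hxe _ h2, map_sum]
      congr 1
      simp only [coeff_monomial]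
      rw [Finset.sum_ite_eq, if_pos h1]

end Truncation

/-! ### Artin–Rees correction of leading exponents -/

section OrderFiltration

variable {R : Type*} [CommRing R]

/-- A series without terms of degree `< k` lies in the `k`-th power of the ideal generated by
the variables. -/
theorem mem_span_range_X_pow {k : ℕ} {f : MvPowerSeries (Fin n) R}
    (hf : ∀ γ : Fin n →₀ ℕ, γ.degree < k → coeff γ f = 0) :
    f ∈ Ideal.span (Set.range (X : Fin n → MvPowerSeries (Fin n) R)) ^ k := by
  classical
  induction k generalizing f with
  | zero => simp
  | succ k ih =>
    -- Assigning to each non-constant monomial a variable dividing it lets the division splitting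
    -- write f as ∑ xⱼ fⱼ.
    have hex : ∀ γ : Fin n →₀ ℕ, ∃ o : Option (Fin n),
        (∀ j, o = some j → Finsupp.single j 1 ≤ γ) ∧ (o = none → γ = 0) := by
      intro γ
      by_cases h : γ = 0
      · exact ⟨none, by simp, fun _ => h⟩
      · obtain ⟨j, hj⟩ := Finsupp.ne_iff.1 h
        refine ⟨some j, fun i hi => ?_, by simp⟩
        obtain rfl := Option.some.inj hi
        rw [Finsupp.single_le_iff]
        exact Nat.one_le_iff_ne_zero.2 hj
    choose σ hσ h0 using hex
    rw [← sum_monomial_mul_quotientPart_add_remainderPart hσ f]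
    have hr : remainderPart σ f = 0 := by
      ext γ
      rw [coeff_remainderPart, map_zero]
      split_ifs with h
      · exact hf γ (by rw [h0 γ h]; simp)
      · rfl
    rw [hr, add_zero]
    refine sum_mem fun j _ => ?_
    rw [pow_succ']
    refine Ideal.mul_mem_mul (Ideal.subset_span ⟨j, rfl⟩) (ih fun γ hγ => ?_)
    rw [coeff_quotientPart]
    split_ifs
    · refine hf _ ?_
      rw [map_add, Finsupp.degree_single]
      omega
    · rfl

/-- Each factor without constant term raises the lowest degree by at least one. -/
theorem coeff_eq_zero_of_mem_span_range_X_pow {k : ℕ} {f : MvPowerSeries (Fin n) R}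
    (hf : f ∈ Ideal.span (Set.range (X : Fin n → MvPowerSeries (Fin n) R)) ^ k)
    {γ : Fin n →₀ ℕ} (hγ : γ.degree < k) : coeff γ f = 0 := by
  classical
  induction k generalizing f γ with
  | zero => omega
  | succ k ih =>
    rw [pow_succ'] at hf
    induction hf using Submodule.mul_induction_on' with
    | mem_mul_mem x hx y hy =>
      have hx0 : coeff 0 x = 0 := by
        induction hx using Submodule.span_induction with
        | mem x hx => obtain ⟨i, rfl⟩ := hx; exact coeff_zero_X i
        | zero => simp
        | add x y _ _ hx hy => rw [map_add, hx, hy, add_zero]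
        | smul a x _ hx =>
          rw [coeff_zero_eq_constantCoeff_apply] at hx ⊢
          rw [smul_eq_mul, map_mul, hx, mul_zero]
      rw [coeff_mul]
      refine Finset.sum_eq_zero fun p hp => ?_
      rw [Finset.HasAntidiagonal.mem_antidiagonal] at hp
      by_cases h : p.1 = 0
      · rw [h, hx0, zero_mul]
      · rw [ih hy, mul_zero]
        have h1 : p.1.degree ≠ 0 := by rwa [Ne, Finsupp.degree_eq_zero_iff]
        have h2 : p.1.degree + p.2.degree = γ.degree := by rw [← map_add, hp]
        omega
    | add x _ y _ hx hy => rw [map_add, hx, hy, add_zero]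

/-- The ideal of the power series all of whose exponents are `≼ α`. -/
def lowerIdeal (ord : LocalOrder n) (α : Fin n →₀ ℕ) : Ideal (MvPowerSeries (Fin n) R) where
  carrier := {f | ∀ β, ord.lt α β → coeff β f = 0}
  add_mem' ha hb β h := by rw [map_add, ha β h, hb β h, add_zero]
  zero_mem' β _ := map_zero _
  smul_mem' a f hf β h := by
    classical
    rw [smul_eq_mul, coeff_mul]
    refine Finset.sum_eq_zero fun p hp => ?_
    rw [Finset.HasAntidiagonal.mem_antidiagonal] at hp
    rw [hf, mul_zero]
    -- Locality enters here: multiplying by a monomial can only move an exponent down.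
    refine ord.lt_of_lt_of_le h ?_
    rw [← hp, add_comm]
    exact ord.le_of_add _ _

theorem mem_lowerIdeal {ord : LocalOrder n} {α : Fin n →₀ ℕ} {f : MvPowerSeries (Fin n) R} :
    f ∈ lowerIdeal ord α ↔ ∀ β, ord.lt α β → coeff β f = 0 :=
  Iff.rfl

/-- A form of the Artin–Rees lemma for the quotient by an ideal. -/
theorem exists_sub_mem_of_mem_sup_pow {S : Type*} [CommRing S] [IsNoetherianRing S]
    (m L J : Ideal S) :
    ∃ c : ℕ, ∀ k, ∀ s ∈ J, s ∈ L ⊔ m ^ (c + k) → ∃ j ∈ m ^ k * J, s - j ∈ L := by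
  -- Artin–Rees is applied to the image of J in the module S/L.
  obtain ⟨c, hc⟩ := Ideal.exists_pow_inf_eq_pow_smul m (Submodule.map L.mkQ J)
  refine ⟨c, fun k s hs hsup => ?_⟩
  obtain ⟨l, hl, t, ht, rfl⟩ := Submodule.mem_sup.1 hsup
  have h1 : L.mkQ (l + t) ∈ (m ^ (c + k) • ⊤ : Submodule S (S ⧸ L)) ⊓ Submodule.map L.mkQ J := by
    refine ⟨?_, Submodule.mem_map_of_mem hs⟩
    have hl0 : L.mkQ l = 0 := (Submodule.Quotient.mk_eq_zero L).2 hl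
    have : L.mkQ t = t • L.mkQ 1 := by rw [← map_smul, smul_eq_mul, mul_one]
    rw [map_add, hl0, zero_add, this]
    exact Submodule.smul_mem_smul ht trivial
  rw [hc _ (Nat.le_add_right _ _), Nat.add_sub_cancel_left] at h1
  have h2 := Submodule.smul_mono (le_refl (m ^ k)) inf_le_right h1
  rw [← Submodule.map_smul''] at h2
  obtain ⟨j, hj, hjs⟩ := h2
  refine ⟨j, hj, (Submodule.Quotient.mk_eq_zero L).1 ?_⟩
  rw [← Submodule.mkQ_apply, map_sub, hjs, sub_self]

/-- By the Artin–Rees lemma, an element of an ideal whose terms of sufficiently small degree are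
`≼ α` can be corrected, without changing its coefficient at `α`, to an element of the ideal all of
whose terms are `≼ α`. -/
theorem exists_forall_mem_lowerIdeal [IsNoetherianRing R] (ord : LocalOrder n) (α : Fin n →₀ ℕ)
    (J : Ideal (MvPowerSeries (Fin n) R)) :
    ∃ N : ℕ, ∀ s ∈ J, (∀ β : Fin n →₀ ℕ, β.degree < N → ord.lt α β → coeff β s = 0) →
      ∃ i ∈ J, i ∈ lowerIdeal ord α ∧ coeff α i = coeff α s := by
  classical
  obtain ⟨c, hc⟩ := exists_sub_mem_of_mem_sup_pow
    (Ideal.span (Set.range (X : Fin n → MvPowerSeries (Fin n) R))) (lowerIdeal ord α) J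
  -- The power deg α + 1 ensures that the correction `j` has no term at α; `t` is the part of `s`
  -- above α, of degree at least the bound.
  refine ⟨c + (α.degree + 1), fun s hs hlow => ?_⟩
  let t : MvPowerSeries (Fin n) R := fun β => if ord.lt α β then coeff β s else 0
  have ht : ∀ β, coeff β t = if ord.lt α β then coeff β s else 0 := fun β => rfl
  obtain ⟨j, hj, hjs⟩ := hc (α.degree + 1) s hs <| by
    rw [← sub_add_cancel s t]
    refine Submodule.add_mem_sup (fun β hβ => ?_) (mem_span_range_X_pow fun β hβ => ?_)
    · rw [map_sub, ht, if_pos hβ, sub_self]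
    · rw [ht]
      split_ifs with h
      · exact hlow β hβ h
      · rfl
  have hjJ : j ∈ J := Ideal.mul_le_right hj
  have hjα : coeff α j = 0 :=
    coeff_eq_zero_of_mem_span_range_X_pow (Ideal.mul_le_left hj) (lt_add_one α.degree)
  exact ⟨s - j, sub_mem hs hjJ, hjs, by rw [map_sub, hjα, sub_zero]⟩

end OrderFiltration

theorem map_surjective {R S : Type*} [CommRing R] [CommRing S] {φ : R →+* S}
    (hφ : Function.Surjective φ) :
    Function.Surjective (map φ : MvPowerSeries (Fin n) R →+* MvPowerSeries (Fin n) S) := by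
  intro f
  choose c hc using fun γ => hφ (coeff γ f)
  exact ⟨c, MvPowerSeries.ext fun γ => hc γ⟩

/-! ### Clearing denominators and leading exponents modulo Q -/

section Denominators

variable {C A : Type*} [CommRing C] [CommRing A]

/-- A linear combination involves finitely many scalars, hence has a common denominator. -/
theorem exists_isUnit_smul_eq_map {ψ : C →+* A}
    (hden : ∀ a : A, ∃ d c : C, IsUnit (ψ d) ∧ ψ d * a = ψ c)
    (J : Ideal (MvPowerSeries (Fin n) C)) {F : MvPowerSeries (Fin n) A}
    (hF : F ∈ Submodule.span A (map ψ '' (J : Set (MvPowerSeries (Fin n) C)))) :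
    ∃ d : C, IsUnit (ψ d) ∧ ∃ s ∈ J, map ψ s = ψ d • F := by
  have hmap : ∀ (c : C) (s : MvPowerSeries (Fin n) C), map ψ (c • s) = ψ c • map ψ s := by
    intro c s
    ext γ
    simp
  induction hF using Submodule.span_induction with
  | mem x hx =>
    obtain ⟨s, hs, rfl⟩ := hx
    exact ⟨1, by simp, s, hs, by simp⟩
  | zero => exact ⟨1, by simp, 0, zero_mem _, by simp⟩
  | add x y _ _ hx hy =>
    obtain ⟨d, hd, s, hs, hse⟩ := hx
    obtain ⟨d', hd', s', hs', hse'⟩ := hy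
    refine ⟨d * d', by rw [map_mul]; exact hd.mul hd', d' • s + d • s',
      add_mem (Submodule.smul_of_tower_mem _ _ hs) (Submodule.smul_of_tower_mem _ _ hs'), ?_⟩
    rw [map_add, hmap, hmap, hse, hse', smul_add, map_mul, smul_smul, smul_smul,
      mul_comm (ψ d') (ψ d)]
  | smul a x _ hx =>
    obtain ⟨d, hd, s, hs, hse⟩ := hx
    obtain ⟨d', c, hd', hc⟩ := hden a
    refine ⟨d * d', by rw [map_mul]; exact hd.mul hd', c • s,
      Submodule.smul_of_tower_mem _ _ hs, ?_⟩
    rw [hmap, hse, ← hc, smul_smul, smul_smul, map_mul]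
    congr 1
    ring

theorem mem_expSetMod {ord : LocalOrder n} {Q : Ideal C} {J : Ideal (MvPowerSeries (Fin n) C)}
    {s : MvPowerSeries (Fin n) C} (hs : s ∈ J) {α : Fin n →₀ ℕ} (hα : coeff α s ∉ Q)
    (h : ∀ β, ord.lt α β → coeff β s ∈ Q) : α ∈ expSetMod ord Q J :=
  ⟨s, hs, ⟨α, hα⟩, ord.max_eq hα fun β hβ => ord.not_lt.1 fun hlt => hβ (h β hlt)⟩

/-- Inverting elements outside `Q` does not create new leading exponents modulo `Q`. -/
theorem mem_expSetMod_of_mem_map (ord : LocalOrder n) (Q : Ideal C)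
    (hfin : IsNoetherianRing (C ⧸ Q) ∨ ∀ α : Fin n →₀ ℕ, {β | ord.lt α β}.Finite)
    (J : Ideal (MvPowerSeries (Fin n) C)) {ψ : C →+* A} (hker : ∀ c, ψ c = 0 ↔ c ∈ Q)
    (hden : ∀ a : A, ∃ d c : C, IsUnit (ψ d) ∧ ψ d * a = ψ c)
    {F : MvPowerSeries (Fin n) A} (hF : F ∈ J.map (map ψ)) {α : Fin n →₀ ℕ}
    (hα : coeff α F ≠ 0) (hlt : ∀ β, ord.lt α β → coeff β F = 0) :
    α ∈ expSetMod ord Q J := by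
  classical
  have key : ∀ U : Finset (Fin n →₀ ℕ), ∃ s ∈ J, (α ∈ U → coeff α s ∉ Q) ∧
      ∀ β ∈ U, ord.lt α β → coeff β s ∈ Q := by
    intro U
    obtain ⟨F', hF', hFU⟩ := exists_mem_span_coeff_eq ψ J hF U
    obtain ⟨d, hd, s, hs, hsF⟩ := exists_isUnit_smul_eq_map hden J hF'
    have hc : ∀ γ ∈ U, ψ (coeff γ s) = ψ d * coeff γ F := by
      intro γ hγ
      rw [← coeff_map, hsF, coeff_smul, hFU γ hγ]
    refine ⟨s, hs, fun hU => ?_, fun β hβ hαβ => ?_⟩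
    · rw [← hker, hc α hU]
      exact fun h => hα ((hd.mul_right_eq_zero).1 h)
    · rw [← hker, hc β hβ, hlt β hαβ, mul_zero]
  rcases hfin with hN | hfin
  · obtain ⟨N, hN⟩ := exists_forall_mem_lowerIdeal ord α (J.map (map (Ideal.Quotient.mk Q)))
    have hfinite :=
      -- The maximum puts α itself among the controlled exponents.
      Finsupp.finite_of_degree_lt (σ := Fin n) (max N (α.degree + 1))
    obtain ⟨s, hs, hsα, hsl⟩ := key hfinite.toFinset
    obtain ⟨i, hi, hil, hiα⟩ := hN (map (Ideal.Quotient.mk Q) s) (Ideal.mem_map_of_mem _ hs)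
      fun β hβ hαβ => by
        rw [coeff_map, Ideal.Quotient.eq_zero_iff_mem]
        exact hsl β (by simp [hβ]) hαβ
    obtain ⟨i', hi', rfl⟩ := (Ideal.mem_map_iff_of_surjective _
      (map_surjective Ideal.Quotient.mk_surjective)).1 hi
    refine mem_expSetMod hi' (α := α) ?_ fun β hβ => ?_
    · rw [← Ideal.Quotient.eq_zero_iff_mem, ← coeff_map, hiα, coeff_map,
        Ideal.Quotient.eq_zero_iff_mem]
      exact hsα (by simp)
    · rw [← Ideal.Quotient.eq_zero_iff_mem, ← coeff_map]
      exact hil β hβ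
  · obtain ⟨s, hs, hsα, hsl⟩ := key (insert α (hfin α).toFinset)
    exact mem_expSetMod hs (hsα (Finset.mem_insert_self _ _)) fun β hβ =>
      hsl β (Finset.mem_insert_of_mem ((hfin α).mem_toFinset.2 hβ)) hβ

end Denominators

/-! ### Vanishing of remainders and its specialization -/

section Remainder

variable {C A K : Type*} [CommRing C] [CommRing A] [CommRing K] {ι : Type*} [Fintype ι]
  (ord : LocalOrder n) {σ : (Fin n →₀ ℕ) → Option ι} {e : ι → (Fin n →₀ ℕ)}
  {g : ι → MvPowerSeries (Fin n) A}

/-- If no exponent outside the diagram given by `σ` is the leading exponent of an element of `I`,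
then dividing an element of `I` by elements of `I` leaves no remainder. -/
theorem remainderPart_eq_zero_of_recombine_mem {I : Ideal (MvPowerSeries (Fin n) A)}
    (hI : ∀ F ∈ I, ∀ α, coeff α F ≠ 0 → (∀ β, ord.lt α β → coeff β F = 0) → σ α ≠ none)
    (hgI : ∀ j, g j ∈ I) {s : MvPowerSeries (Fin n) A} (hs : recombine σ e g s ∈ I) :
    remainderPart σ s = 0 := by
  classical
  by_contra hne
  have hr : remainderPart σ s ∈ I := by
    rw [recombine_apply] at hs
    exact (Submodule.add_mem_iff_right _
      (sum_mem fun j _ => I.mul_mem_left _ (hgI j))).1 hs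
  have hS : {α | coeff α (remainderPart σ s) ≠ 0}.Nonempty :=
    (ne_zero_iff_exists_coeff_ne_zero _).1 hne
  obtain ⟨α, hα, hmax⟩ := ord.exists_max _ hS
  have hσα := hI _ hr α hα fun β hβ => by
    by_contra h
    exact ord.not_lt.2 (hmax β h) hβ
  apply hα
  rw [coeff_remainderPart, if_neg hσα]

/-- Division with zero remainder specializes: if the elements of `J` leave no remainder over `A`,
then the elements of the ideal generated by `J` leave no remainder after a ring homomorphism. -/
theorem exists_recombine_eq_of_mem_map
    (hσ : ∀ γ j, σ γ = some j → e j ≤ γ) (hg : ∀ j, coeff (e j) (g j) = 1)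
    (hlt : ∀ j γ, ord.lt (e j) γ → coeff γ (g j) = 0)
    (ψ : C →+* A) (φ : A →+* K) (J : Ideal (MvPowerSeries (Fin n) C))
    (hJ : ∀ s, recombine σ e g s ∈ J.map (map ψ) → remainderPart σ s = 0)
    {F : MvPowerSeries (Fin n) K} (hF : F ∈ J.map (map (φ.comp ψ))) :
    ∃ s, recombine σ e (fun j => map φ (g j)) s = F ∧ remainderPart σ s = 0 := by
  classical
  have hg' : ∀ j, coeff (e j) (map φ (g j)) = 1 := fun j => by rw [coeff_map, hg, map_one]
  have hlt' : ∀ j γ, ord.lt (e j) γ → coeff γ (map φ (g j)) = 0 := fun j γ h => by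
    rw [coeff_map, hlt j γ h, map_zero]
  obtain ⟨s, rfl⟩ := recombine_surjective ord hσ hg' hlt' F
  refine ⟨s, rfl, ?_⟩
  ext α
  rw [coeff_remainderPart, map_zero]
  split_ifs with hα
  swap
  · rfl
  obtain ⟨U, hU⟩ := exists_finset_coeff_eq_zero ord hσ hg' hlt' α
  obtain ⟨F', hF', hFU⟩ := exists_mem_span_coeff_eq (φ.comp ψ) J hF U
  -- Series divided without remainder form a K-submodule, so it is enough to divide the images of
  -- elements of J, which is done over `A`.
  have hle : Submodule.span K (map (φ.comp ψ) '' (J : Set (MvPowerSeries (Fin n) C))) ≤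
      (LinearMap.ker (remainderPart σ)).map (recombine σ e fun j => map φ (g j)) := by
    rw [Submodule.span_le]
    rintro _ ⟨f, hf, rfl⟩
    obtain ⟨t, ht⟩ := recombine_surjective ord hσ hg hlt (map ψ f)
    refine ⟨map φ t, ?_, ?_⟩
    · have h0 := hJ t (ht ▸ Ideal.mem_map_of_mem _ hf)
      rw [SetLike.mem_coe, LinearMap.mem_ker]
      ext δ
      have := congrArg (coeff δ) h0
      rw [coeff_remainderPart] at this ⊢
      rw [coeff_map]
      split_ifs at this ⊢ with h
      · rw [this, map_zero, map_zero, map_zero]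
      · simp
    · rw [← map_recombine, ht, map_comp, RingHom.comp_apply]
  obtain ⟨s', hs', rfl⟩ := hle hF'
  -- The images of `s` and `s'` agree on `U`, which forces their coefficients at α to agree.
  have h1 := hU (s - s') fun γ hγ => by rw [map_sub, map_sub, hFU γ hγ, sub_self]
  have h2 := congrArg (coeff α) (LinearMap.mem_ker.1 hs')
  rw [coeff_remainderPart, if_pos hα, map_zero] at h2
  rwa [map_sub, h2, sub_zero] at h1

/-- The leading exponent of a series that is divided without remainder. -/
theorem exists_leading_of_recombine {s : MvPowerSeries (Fin n) A}
    (hσ : ∀ γ j, σ γ = some j → e j ≤ γ) (hg : ∀ j, coeff (e j) (g j) = 1)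
    (hlt : ∀ j γ, ord.lt (e j) γ → coeff γ (g j) = 0) (hs : remainderPart σ s = 0)
    (hne : recombine σ e g s ≠ 0) :
    ∃ α, σ α ≠ none ∧ coeff α (recombine σ e g s) ≠ 0 ∧
      ∀ β, ord.lt α β → coeff β (recombine σ e g s) = 0 := by
  classical
  have hs0 : s ≠ 0 := by
    rintro rfl
    exact hne (map_zero _)
  obtain ⟨α, hα, hmax⟩ := ord.exists_max {α | coeff α s ≠ 0}
    ((ne_zero_iff_exists_coeff_ne_zero _).1 hs0)
  have hgt : ∀ β, ord.lt α β → coeff β s = 0 := fun β hβ => by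
    by_contra h
    exact ord.not_lt.2 (hmax β h) hβ
  refine ⟨α, fun h => hα ?_, ?_, fun β hβ => ?_⟩
  · have := congrArg (coeff α) hs
    rwa [coeff_remainderPart, if_pos h, map_zero] at this
  · rwa [coeff_recombine_of_forall_lt ord hσ hg hlt hgt]
  · rw [coeff_recombine_of_forall_lt ord hσ hg hlt fun γ hγ =>
      hgt γ (ord.lt_of_lt_of_le hβ hγ.1), hgt β hβ]

end Remainder

/-! ### Specialization of generic standard bases -/

section Generic

variable {C : Type*} [CommRing C]

theorem specializeIdeal_eq_map (P : Ideal C) [P.IsPrime] (J : Ideal (MvPowerSeries (Fin n) C)) :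
    specializeIdeal P J = J.map (map (specialize P)) :=
  rfl

theorem specializeAway_comp_algebraMap (P : Ideal C) [P.IsPrime] {h : C} (hP : h ∉ P) :
    (specializeAway P hP).comp (algebraMap C (Localization.Away h)) = specialize P :=
  IsLocalization.Away.lift_comp h (isUnit_specialize P hP)

theorem specialize_eq_zero_iff (P : Ideal C) [P.IsPrime] {c : C} :
    specialize P c = 0 ↔ c ∈ P := by
  rw [specialize, RingHom.comp_apply,
    FaithfulSMul.algebraMap_eq_zero_iff (C ⧸ P) (FractionRing (C ⧸ P)),
    Ideal.Quotient.eq_zero_iff_mem]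

theorem extendAway_le_ker_specializeAway {Q P : Ideal C} [P.IsPrime] (hQP : Q ≤ P) {h : C}
    (hP : h ∉ P) : extendAway Q h ≤ RingHom.ker (specializeAway P hP) := by
  rw [extendAway, Ideal.map_le_iff_le_comap]
  intro c hc
  rw [Ideal.mem_comap, RingHom.mem_ker, ← RingHom.comp_apply, specializeAway_comp_algebraMap,
    specialize_eq_zero_iff]
  exact hQP hc

/-- Specialization at Q itself kills Q[h⁻¹] and detects membership in Q. -/
theorem algebraMap_mem_extendAway_iff {Q : Ideal C} [Q.IsPrime] {h : C} (hQ : h ∉ Q) {c : C} :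
    algebraMap C (Localization.Away h) c ∈ extendAway Q h ↔ c ∈ Q := by
  refine ⟨fun hc => ?_, fun hc => Ideal.mem_map_of_mem _ hc⟩
  have := extendAway_le_ker_specializeAway le_rfl hQ hc
  rwa [RingHom.mem_ker, ← RingHom.comp_apply, specializeAway_comp_algebraMap,
    specialize_eq_zero_iff] at this

theorem exists_isUnit_mul_eq {h : C} (a : Localization.Away h) :
    ∃ d c : C, IsUnit (algebraMap C (Localization.Away h) d) ∧
      algebraMap C (Localization.Away h) d * a = algebraMap C (Localization.Away h) c := by
  obtain ⟨⟨c, d⟩, hcd⟩ := IsLocalization.surj (Submonoid.powers h) a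
  exact ⟨d, c, IsLocalization.map_units _ d, by rw [mul_comm]; exact hcd⟩

theorem IsGenericStandardBasis.isUnit_leadCoeffMod {ord : LocalOrder n} {Q : Ideal C}
    {J : Ideal (MvPowerSeries (Fin n) C)} {h : C}
    {G : Set (MvPowerSeries (Fin n) (Localization.Away h))}
    (hG : IsGenericStandardBasis ord Q J h G) {g : MvPowerSeries (Fin n) (Localization.Away h)}
    (hg : g ∈ G) : IsUnit (leadCoeffMod ord (extendAway Q h) g) := by
  obtain ⟨c, c', -, hcc, hch⟩ := hG.numerator_dvd g hg
  have : IsUnit (algebraMap C (Localization.Away h) c) :=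
    isUnit_of_dvd_unit (_root_.map_dvd _ hch) (IsLocalization.Away.algebraMap_isUnit h)
  rw [← hcc] at this
  exact isUnit_of_mul_isUnit_left this

theorem coeff_mem_of_leadExpMod_lt (ord : LocalOrder n) {R : Type*} [CommRing R] {q : Ideal R}
    {f : MvPowerSeries (Fin n) R} {β : Fin n →₀ ℕ}
    (h : ord.lt (leadExpMod ord q f) β) : coeff β f ∈ q := by
  by_contra hβ
  exact ord.not_lt.2 ((ord.max_spec (newtonDiagramMod q f) ⟨β, hβ⟩).2 β hβ) h

theorem leadExp_eq {K : Type*} [Field K] {ord : LocalOrder n} {f : MvPowerSeries (Fin n) K}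
    {α : Fin n →₀ ℕ} (hα : coeff α f ≠ 0) (h : ∀ β, ord.lt α β → coeff β f = 0) :
    leadExp ord f = α :=
  ord.max_eq hα fun β hβ => ord.not_lt.1 fun hlt => hβ (h β hlt)

theorem translate_leadExp_subset {K : Type*} [Field K] {ord : LocalOrder n}
    {I : Ideal (MvPowerSeries (Fin n) K)} {f : MvPowerSeries (Fin n) K} (hf : f ∈ I)
    (hne : f ≠ 0) : translate (leadExp ord f) ⊆ expSet ord I := by
  rintro _ ⟨γ, rfl⟩
  obtain ⟨hα, hmax⟩ := ord.max_spec (newtonDiagram f)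
    ((ne_zero_iff_exists_coeff_ne_zero _).1 hne)
  have hc : coeff (leadExp ord f + γ) (monomial γ 1 * f) ≠ 0 := by
    rw [add_comm, coeff_add_monomial_mul, one_mul]
    exact hα
  refine ⟨monomial γ 1 * f, I.mul_mem_left _ hf, fun h => hc (by rw [h, map_zero]),
    leadExp_eq hc fun β hβ => ?_⟩
  rw [coeff_monomial_mul]
  split_ifs with hγ
  · obtain ⟨δ, rfl⟩ := exists_add_of_le hγ
    rw [add_tsub_cancel_left, one_mul]
    by_contra h
    refine ord.not_lt.2 ?_ hβ
    have := ord.add_le_add _ _ γ (hmax δ h)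
    rwa [add_comm δ] at this
  · rfl

theorem IsGenericStandardBasis.coeff_specializeSeries_ne_zero {ord : LocalOrder n} {Q : Ideal C}
    {J : Ideal (MvPowerSeries (Fin n) C)} {h : C}
    {G : Set (MvPowerSeries (Fin n) (Localization.Away h))}
    (hG : IsGenericStandardBasis ord Q J h G) (P : Ideal C) [P.IsPrime] (hP : h ∉ P)
    {g : MvPowerSeries (Fin n) (Localization.Away h)} (hg : g ∈ G) :
    coeff (leadExpMod ord (extendAway Q h) g) (specializeSeries P hP g) ≠ 0 := by
  rw [specializeSeries, coeff_map]
  exact ((hG.isUnit_leadCoeffMod hg).map (specializeAway P hP)).ne_zero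

/-- The leading coefficient is a unit, so it survives; the coefficients above it lie in Q[h⁻¹] and
die because Q ≤ P. -/
theorem IsGenericStandardBasis.leadExp_specializeSeries {ord : LocalOrder n} {Q : Ideal C}
    {J : Ideal (MvPowerSeries (Fin n) C)} {h : C}
    {G : Set (MvPowerSeries (Fin n) (Localization.Away h))}
    (hG : IsGenericStandardBasis ord Q J h G) (P : Ideal C) [P.IsPrime] (hQP : Q ≤ P) (hP : h ∉ P)
    {g : MvPowerSeries (Fin n) (Localization.Away h)} (hg : g ∈ G) :
    leadExp ord (specializeSeries P hP g) = leadExpMod ord (extendAway Q h) g := by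
  refine leadExp_eq (hG.coeff_specializeSeries_ne_zero P hP hg) fun β hβ => ?_
  rw [specializeSeries, coeff_map]
  exact extendAway_le_ker_specializeAway hQP hP (coeff_mem_of_leadExpMod_lt ord hβ)

theorem IsGenericStandardBasis.specializeSeries_mem {ord : LocalOrder n} {Q : Ideal C}
    {J : Ideal (MvPowerSeries (Fin n) C)} {h : C}
    {G : Set (MvPowerSeries (Fin n) (Localization.Away h))}
    (hG : IsGenericStandardBasis ord Q J h G) (P : Ideal C) [P.IsPrime] (hP : h ∉ P)
    {g : MvPowerSeries (Fin n) (Localization.Away h)} (hg : g ∈ G) :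
    specializeSeries P hP g ∈ specializeIdeal P J := by
  have := Ideal.mem_map_of_mem (map (specializeAway P hP)) (hG.mem g hg)
  rwa [Ideal.map_map, ← map_comp, specializeAway_comp_algebraMap] at this

/-- The leading exponents of the specialized ideal lie in those of the ideal modulo `Q`. -/
theorem IsGenericStandardBasis.expSet_specializeIdeal_subset {ord : LocalOrder n} {Q : Ideal C}
    [Q.IsPrime] {J : Ideal (MvPowerSeries (Fin n) C)} {h : C}
    {G : Set (MvPowerSeries (Fin n) (Localization.Away h))}
    (hG : IsGenericStandardBasis ord Q J h G)
    (hfin : IsNoetherianRing (C ⧸ Q) ∨ ∀ α : Fin n →₀ ℕ, {β | ord.lt α β}.Finite)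
    (P : Ideal C) [P.IsPrime] (hQP : Q ≤ P) (hP : h ∉ P) :
    expSet ord (specializeIdeal P J) ⊆ expSetMod ord Q J := by
  classical
  have : Fintype G := hG.finite.fintype
  let q := extendAway Q h
  let mk := Ideal.Quotient.mk q
  let ψ : C →+* Localization.Away h ⧸ q := mk.comp (algebraMap C (Localization.Away h))
  let φ : Localization.Away h ⧸ q →+* FractionRing (C ⧸ P) :=
    Ideal.Quotient.lift q (specializeAway P hP)
      fun a ha => extendAway_le_ker_specializeAway hQP hP ha
  have hφψ : φ.comp ψ = specialize P := by
    rw [← specializeAway_comp_algebraMap P hP]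
    rfl
  have hker : ∀ c, ψ c = 0 ↔ c ∈ Q := fun c =>
    Ideal.Quotient.eq_zero_iff_mem.trans (algebraMap_mem_extendAway_iff hG.notMem)
  have hden : ∀ a, ∃ d c : C, IsUnit (ψ d) ∧ ψ d * a = ψ c := by
    intro a
    obtain ⟨a, rfl⟩ := Ideal.Quotient.mk_surjective a
    obtain ⟨d, c, hd, hdc⟩ := exists_isUnit_mul_eq a
    refine ⟨d, c, hd.map mk, ?_⟩
    change mk _ * mk a = mk _
    rw [← map_mul, hdc]
  let e : G → (Fin n →₀ ℕ) := fun g => leadExpMod ord q g.1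
  choose u hu using fun g : G => (hG.isUnit_leadCoeffMod g.2)
  -- The unit makes the leading coefficient 1; the quotient by `q` removes the terms above it.
  let g' : G → MvPowerSeries (Fin n) (Localization.Away h ⧸ q) := fun g =>
    map mk (MvPowerSeries.C (↑(u g)⁻¹ : Localization.Away h) * g.1)
  have hg1 : ∀ j, coeff (e j) (g' j) = 1 := by
    intro j
    rw [coeff_map, coeff_C_mul]
    change mk (_ * leadCoeffMod ord (extendAway Q h) j.1) = 1
    rw [← hu, Units.inv_mul, map_one]
  have hlt : ∀ j γ, ord.lt (e j) γ → coeff γ (g' j) = 0 := by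
    intro j γ hγ
    rw [coeff_map, coeff_C_mul]
    exact Ideal.Quotient.eq_zero_iff_mem.2
      (q.mul_mem_left _ (coeff_mem_of_leadExpMod_lt ord hγ))
  have hgJ : ∀ j, g' j ∈ J.map (map ψ) := by
    intro j
    have := Ideal.mem_map_of_mem (map mk) (Ideal.mul_mem_left _
      (MvPowerSeries.C (↑(u j)⁻¹ : Localization.Away h)) (hG.mem j.1 j.2))
    rwa [Ideal.map_map, ← map_comp] at this
  -- Each exponent of the diagram is assigned one element of G whose leading exponent divides it;
  -- all others go to the remainder.
  have hex : ∀ γ : Fin n →₀ ℕ, ∃ o : Option G,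
      (∀ j, o = some j → e j ≤ γ) ∧ (o ≠ none ↔ γ ∈ expSetMod ord Q J) := by
    intro γ
    rw [hG.exp_eq]
    by_cases hγ : γ ∈ ⋃ g ∈ G, translate (leadExpMod ord (extendAway Q h) g)
    · obtain ⟨g, hg, hgγ⟩ := Set.mem_iUnion₂.1 hγ
      refine ⟨some ⟨g, hg⟩, fun j hj => ?_, by simp [hγ]⟩
      obtain rfl := Option.some.inj hj
      exact mem_translate.1 hgγ
    · exact ⟨none, by simp, by simp [hγ]⟩
  choose σ hσ hσE using hex
  rintro α ⟨F, hF, hF0, rfl⟩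
  rw [specializeIdeal_eq_map, ← hφψ] at hF
  obtain ⟨s, rfl, hs⟩ := exists_recombine_eq_of_mem_map ord hσ hg1 hlt ψ φ J
    (fun s hs => remainderPart_eq_zero_of_recombine_mem ord
      (fun F hF α hα hβ => (hσE α).2
        (mem_expSetMod_of_mem_map ord Q hfin J hker hden hF hα hβ)) hgJ hs) hF
  obtain ⟨α, hα, hc, hβ⟩ := exists_leading_of_recombine ord hσ
    (fun j => by rw [coeff_map, hg1, map_one])
    (fun j γ h => by rw [coeff_map, hlt j γ h, map_zero]) hs hF0
  rw [leadExp_eq hc hβ]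
  exact (hσE α).1 hα

end Generic

end GenericSB

end

theorem mainTheorem1 {C : Type*} [CommRing C] [IsDomain C] {n : ℕ}
    (ord : GenericSB.LocalOrder n) (Q : Ideal C) [Q.IsPrime]
    (hfin : IsNoetherianRing (C ⧸ Q) ∨ ∀ α : Fin n →₀ ℕ, {β | ord.lt α β}.Finite)
    (J : Ideal (MvPowerSeries (Fin n) C)) (h : C)
    (G : Set (MvPowerSeries (Fin n) (Localization.Away h)))
    (hG : GenericSB.IsGenericStandardBasis ord Q J h G)
    (P : Ideal C) [P.IsPrime] (hQP : Q ≤ P) (hP : h ∉ P) :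
    (∀ g ∈ G, GenericSB.specializeSeries P hP g ∈ GenericSB.specializeIdeal P J) ∧
    GenericSB.expSet ord (GenericSB.specializeIdeal P J) =
      ⋃ g ∈ G, GenericSB.translate (GenericSB.leadExp ord (GenericSB.specializeSeries P hP g)) ∧
    (⋃ g ∈ G, GenericSB.translate (GenericSB.leadExp ord (GenericSB.specializeSeries P hP g))) =
      GenericSB.expSetMod ord Q J ∧
    GenericSB.IsStandardBasis ord (GenericSB.specializeIdeal P J)
      (GenericSB.specializeSeries P hP '' G) := by
  have hexp : (⋃ g ∈ G, GenericSB.translate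
      (GenericSB.leadExp ord (GenericSB.specializeSeries P hP g))) =
      GenericSB.expSetMod ord Q J := by
    rw [hG.exp_eq]
    exact Set.iUnion₂_congr fun g hg => by rw [hG.leadExp_specializeSeries P hQP hP hg]
  have hne : ∀ g ∈ G, GenericSB.specializeSeries P hP g ≠ 0 := fun g hg h0 =>
    hG.coeff_specializeSeries_ne_zero P hP hg (by rw [h0, map_zero])
  have hmem : ∀ g ∈ G, GenericSB.specializeSeries P hP g ∈ GenericSB.specializeIdeal P J :=
    fun g hg => hG.specializeSeries_mem P hP hg
  have heq : GenericSB.expSet ord (GenericSB.specializeIdeal P J) =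
      ⋃ g ∈ G, GenericSB.translate
        (GenericSB.leadExp ord (GenericSB.specializeSeries P hP g)) := by
    apply Set.Subset.antisymm
    · rw [hexp]
      exact hG.expSet_specializeIdeal_subset hfin P hQP hP
    · exact Set.iUnion₂_subset fun g hg =>
        GenericSB.translate_leadExp_subset (hmem g hg) (hne g hg)
  refine ⟨hmem, heq, hexp, hG.finite.image _, ?_, ?_, ?_⟩
  · rintro _ ⟨g, hg, rfl⟩
    exact hmem g hg
  · rintro _ ⟨g, hg, rfl⟩
    exact hne g hg
  · rw [heq, Set.biUnion_image]
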